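/- Let $n\ge 0$ and write $z=(x,\xi)$ for the points of $\mathbb{R}^{2n}=\mathbb{R}^n\oplus\mathbb{R}^n$, $\sigma(z,z')=\xi\cdot x'-\xi'\cdot x$ for the standard symplectic form and $J=\begin{pmatrix}0&I\\-I&0\end{pmatrix}$. *The metaplectic group.* $\operatorname{Mp}(2n,\sigma)$ is the group of unitary operators on $L^2(\mathbb{R}^n)$ generated by (a) the modified Fourier transform $\widehat{J}u(x)=e^{-in\pi/4}(2\pi)^{-n/2}\int_{\mathbb{R}^n}e^{-ix\cdot y}u(y)\,dy$; (b) the operators $\widehat{M}_{L,m}u(x)=i^m\sqrt{|\det L|}\,u(Lx)$, with $L\in GL(n,\mathbb{R})$ and $m\in\mathbb{Z}$ even if and only if $\det L>0$; (c) the operators $u(x)\mapsto e^{\frac i2 Px\cdot x}u(x)$, with $P$ a real symmetric $n\times n$ matrix. The projection $\pi:\operatorname{Mp}(2n,\sigma)\to\operatorname{Sp}(2n,\sigma)$ is the group homomorphism that sends these generators to $J$, $\begin{pmatrix}L^{-1}&0\\0&L^T\end{pmatrix}$ and $\begin{pmatrix}I&0\\P&I\end{pmatrix}$ respectively; as a relation,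 its graph is the subgroup of the product generated by these pairs. *The maps $W_{f,\phi}$.* For $u,\phi$ both in $\mathcal{S}(\mathbb{R}^n)$ or both in $L^2(\mathbb{R}^n)$, let $$W(u,\phi)(z)=\left(\tfrac1{2\pi}\right)^n\int_{\mathbb{R}^n}e^{-i\xi\cdot y}u(x+\tfrac12y)\overline{\phi(x-\tfrac12y)}\,dy ;$$ for $u\in\mathcal{S}'(\mathbb{R}^n)$ and $\phi\in\mathcal{S}(\mathbb{R}^n)$ let $W(u,\phi)(z)=\pi^{-n}\langle u,g_z\rangle$ with $g_z(y)=e^{2i\xi\cdot(x-y)}\,\overline{\phi(2x-y)}$, which is the same function when $u\in L^2(\mathbb{R}^n)$. Put $W_\phi u=(2\pi)^{n/2}W(u,\phi)$. For a linear automorphism $f$ of $\mathbb{R}^{2n}$ put $M_fU(z)=\sqrt{|\det f|}\,U(fz)$ and $W_{f,\phi}=M_f^{-1}W_\phi$. **Proposition.** Let $\Omega$ be a real invertible antisymmetric $2n\times2n$ matrix, and $\omega(z,z')=z\cdot\Omega^{-1}z'$ the corresponding symplectic form. Let $f,f'$ be linear automorphisms of $\mathbb{R}^{2n}$ such that $f^*\omega=f'^*\omega=\sigma$,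 that is, $\omega(fz,fz')=\omega(f'z,f'z')=\sigma(z,z')$ for all $z,z'$. Then $f^{-1}f'\in\operatorname{Sp}(2n,\sigma)$, and there is an operator $\widehat{S}_\sigma\in\operatorname{Mp}(2n,\sigma)$ with $\pi(\widehat{S}_\sigma)=f^{-1}f'$. Every such $\widehat{S}_\sigma$ maps $\mathcal{S}(\mathbb{R}^n)$ into itself and extends to a continuous linear operator on $\mathcal{S}'(\mathbb{R}^n)$ (with the topology of pointwise convergence), and, for every such extension, again denoted by $\widehat{S}_\sigma$, $$W_{f',\phi}u=W_{f,\widehat{S}_\sigma\phi}(\widehat{S}_\sigma u)$$ at every point of $\mathbb{R}^{2n}$, in each of the following cases: $u,\phi\in\mathcal{S}(\mathbb{R}^n)$; $u,\phi\in L^2(\mathbb{R}^n)$; $u\in\mathcal{S}'(\mathbb{R}^n)$ and $\phi\in\mathcal{S}(\mathbb{R}^n)$. -/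

import Mathlib

open MeasureTheory Complex
open scoped Matrix SchwartzMap ComplexConjugate

noncomputable section

namespace PhaseSpaceWeyl

/-! ### Configuration space, phase space, symplectic forms -/

/-- Configuration space `ℝⁿ`. -/
abbrev Conf (n : ℕ) : Type := EuclideanSpace ℝ (Fin n)

/-- Phase space `ℝ²ⁿ = ℝⁿ ⊕ ℝⁿ`, with points `z = (x, ξ)`. -/
abbrev Phase (n : ℕ) : Type := Fin n ⊕ Fin n → ℝ

/-- Real `2n × 2n` matrices in `n × n` blocks. -/
abbrev PhaseMatrix (n : ℕ) : Type := Matrix (Fin n ⊕ Fin n) (Fin n ⊕ Fin n) ℝ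

/-- Linear automorphisms of `ℝ²ⁿ`, identified with their matrices. -/
abbrev PhaseAut (n : ℕ) : Type := GL (Fin n ⊕ Fin n) ℝ

variable {n : ℕ}

/-- The position component `x` of `z = (x, ξ)`. -/
def pos (z : Phase n) : Conf n := WithLp.toLp 2 fun j => z (Sum.inl j)

/-- The momentum component `ξ` of `z = (x, ξ)`. -/
def mom (z : Phase n) : Conf n := WithLp.toLp 2 fun j => z (Sum.inr j)

/-- The standard symplectic form `σ(z, z') = ξ · x' - ξ' · x`. -/
def stdForm (z z' : Phase n) : ℝ := inner ℝ (mom z) (pos z') - inner ℝ (mom z') (pos z)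

/-- The form `ω(z, z') = z · Ω⁻¹ z'`. It is a symplectic form when `Ω` is invertible and
antisymmetric. -/
def omegaForm (Ω : PhaseMatrix n) (z z' : Phase n) : ℝ := z ⬝ᵥ (Ω⁻¹ *ᵥ z')

/-- The condition `f^* ω = σ`. -/
def PullsBack (Ω : PhaseMatrix n) (f : PhaseAut n) : Prop :=
  ∀ z z' : Phase n, omegaForm Ω (f.1 *ᵥ z) (f.1 *ᵥ z') = stdForm z z'

/-- The symplectic group `Sp(2n, σ)`: matrices `S` with `S J Sᵀ = J`. -/
abbrev Sp (n : ℕ) : Type := Matrix.symplecticGroup (Fin n) ℝ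

/-! ### The metaplectic group -/

/-- The Hilbert space `L²(ℝⁿ)`. -/
abbrev L2 (n : ℕ) : Type := Lp ℂ 2 (volume : Measure (Conf n))

/-- Unitary operators on `L²(ℝⁿ)`. -/
abbrev UnitaryOp (n : ℕ) : Type := L2 n ≃ₗᵢ[ℂ] L2 n

/-- `MpGenerator T S`: the unitary operator `T` is one of the standard generators of the
metaplectic group, and `S` is its projection on the symplectic group. -/
inductive MpGenerator : UnitaryOp n → Sp n → Prop
  /-- The modified Fourier transform `u ↦ (2πi)^{-n/2} ∫ e^{-i x·y} u(y) dy`, where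
  `i^{-n/2} = e^{-inπ/4}`; its projection is `J : (x, ξ) ↦ (ξ, -x)`. -/
  | fourier (T : UnitaryOp n) (S : Sp n)
      (hT : ∀ u : 𝓢(Conf n, ℂ), (T (u.toLp 2) : Conf n → ℂ) =ᵐ[volume] fun x =>
        exp (-(I * n * Real.pi / 4)) * (((√(2 * Real.pi))⁻¹ ^ n : ℝ) : ℂ) *
          ∫ y : Conf n, exp (-(I * (inner ℝ x y : ℝ))) * u y)
      (hS : (S : PhaseMatrix n) = Matrix.fromBlocks 0 1 (-1) 0) : MpGenerator T S
  /-- The operators `u ↦ i^m √|det L| u(L ·)`, where `m π` is a choice of argument of `det L`;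
  the projection is `(x, ξ) ↦ (L⁻¹ x, Lᵀ ξ)`. -/
  | scaling (L : GL (Fin n) ℝ) (m : ℤ) (hm : Even m ↔ 0 < L.1.det) (T : UnitaryOp n) (S : Sp n)
      (hT : ∀ u : L2 n, (T u : Conf n → ℂ) =ᵐ[volume] fun x =>
        I ^ m * ((√|L.1.det| : ℝ) : ℂ) * u (WithLp.toLp 2 (L.1 *ᵥ x.ofLp)))
      (hS : (S : PhaseMatrix n) = Matrix.fromBlocks (L⁻¹).1 0 0 (L.1)ᵀ) : MpGenerator T S
  /-- The chirps `u ↦ e^{(i/2) P x·x} u(x)`, with `P` symmetric; the projection is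
  `(x, ξ) ↦ (x, ξ + P x)`. -/
  | chirp (P : Matrix (Fin n) (Fin n) ℝ) (hP : P.IsSymm) (T : UnitaryOp n) (S : Sp n)
      (hT : ∀ u : L2 n, (T u : Conf n → ℂ) =ᵐ[volume] fun x =>
        exp (I / 2 * ((x.ofLp ⬝ᵥ (P *ᵥ x.ofLp) : ℝ) : ℂ)) * u x)
      (hS : (S : PhaseMatrix n) = Matrix.fromBlocks 1 0 P 1) : MpGenerator T S

/-- The graph of the covering projection `π : Mp(2n, σ) → Sp(2n, σ)`: the subgroup of
`U(L²(ℝⁿ)) × Sp(2n, σ)` generated by the pairs `(T, S)` made of a generator `T` and of its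
projection `S`. -/
def mpGraph (n : ℕ) : Subgroup (UnitaryOp n × Sp n) :=
  Subgroup.closure {p | MpGenerator p.1 p.2}

/-- The metaplectic group `Mp(2n, σ)`: the group of unitary operators on `L²(ℝⁿ)` generated by
the standard generators. -/
def Mp (n : ℕ) : Subgroup (UnitaryOp n) := (mpGraph n).map (MonoidHom.fst _ _)

/-- `π(T) = S`. -/
def ProjectsTo (T : Mp n) (S : Sp n) : Prop := ((T : UnitaryOp n), S) ∈ mpGraph n

/-! ### The cross-Wigner transform and the maps `W_{f,φ}` -/

/-- The cross-Wigner transform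
`W(u, v)(z) = (2π)^{-n} ∫ e^{-iξ·y} u(x + y/2) conj (v(x - y/2)) dy`.
For `u`, `v` in `L²` the integral converges absolutely at every `z` and depends only on the
classes of `u` and `v`. -/
def crossWigner (u v : Conf n → ℂ) (z : Phase n) : ℂ :=
  (1 / (2 * Real.pi) : ℂ) ^ n * ∫ y : Conf n, exp (-(I * (inner ℝ (mom z) y : ℝ))) *
    u (pos z + (1 / 2 : ℝ) • y) * conj (v (pos z - (1 / 2 : ℝ) • y))

/-- The factor `(2π)^{n/2}`. -/
def wNorm (n : ℕ) : ℂ := ((√(2 * Real.pi) ^ n : ℝ) : ℂ)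

/-- `W_φ u = (2π)^{n/2} W(u, φ)`. -/
def wavepacket (φ u : Conf n → ℂ) (z : Phase n) : ℂ := wNorm n * crossWigner u φ z

/-- The function `√|det f| U(f z)`. -/
def pullFun (f : PhaseAut n) (U : Phase n → ℂ) (z : Phase n) : ℂ :=
  ((√|f.1.det| : ℝ) : ℂ) * U (f.1 *ᵥ z)

theorem pullFun_pullFun_of_mul_eq_one (f g : PhaseAut n) (h : f * g = 1) (U : Phase n → ℂ) :
    pullFun g (pullFun f U) = U := by
  have h' : f.1 * g.1 = 1 := by
    have := congrArg Units.val h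
    simpa using this
  have hd : |f.1.det| * |g.1.det| = 1 := by
    rw [← abs_mul, ← Matrix.det_mul, h']; simp
  funext z
  simp only [pullFun, Matrix.mulVec_mulVec, h', Matrix.one_mulVec]
  rw [← mul_assoc, ← ofReal_mul, mul_comm, ← Real.sqrt_mul (abs_nonneg _), mul_comm |g.1.det|, hd]
  simp

/-- The operator `M_f U(z) = √|det f| U(f z)`, as a bijection of the functions on phase space. -/
def opM (f : PhaseAut n) : (Phase n → ℂ) ≃ (Phase n → ℂ) where
  toFun := pullFun f
  invFun := pullFun f⁻¹
  left_inv U := pullFun_pullFun_of_mul_eq_one f f⁻¹ (mul_inv_cancel f) U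
  right_inv U := pullFun_pullFun_of_mul_eq_one f⁻¹ f (inv_mul_cancel f) U

/-- `W_{f,φ} u = M_f⁻¹ W_φ u`, for functions `φ`, `u` (Schwartz or square integrable). -/
def wavepacketMap (f : PhaseAut n) (φ u : Conf n → ℂ) : Phase n → ℂ :=
  (opM f).symm (wavepacket φ u)

/-! ### Tempered distributions -/

theorem hasTemperateGrowth_expI : (fun t : ℝ => exp (I * t)).HasTemperateGrowth := by
  have hsm : ContDiff ℝ ⊤ (fun t : ℝ => exp (I * t)) :=
    (contDiff_const.mul ofRealCLM.contDiff).cexp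
  have hd : ∀ k : ℕ, iteratedDeriv k (fun t : ℝ => exp (I * t)) =
      fun t : ℝ => I ^ k * exp (I * t) := by
    intro k
    induction k with
    | zero => simp
    | succ k ih =>
      rw [iteratedDeriv_succ, ih]
      funext t
      have h1 : HasDerivAt (fun t : ℝ => exp (I * t)) (exp (I * t) * (I * 1)) t :=
        ((ofRealCLM.hasDerivAt (x := t)).const_mul I).cexp
      rw [(h1.const_mul (I ^ k)).deriv]
      ring
  refine ⟨hsm.of_le le_top, fun k => ⟨0, 1, fun t => ?_⟩⟩
  rw [norm_iteratedFDeriv_eq_norm_iteratedDeriv, hd]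
  simp [norm_exp]

theorem hasTemperateGrowth_phase (x ξ : Conf n) :
    (fun y : Conf n => exp (I * (2 * inner ℝ ξ (x - y) : ℝ))).HasTemperateGrowth := by
  have h : (fun y : Conf n => 2 * inner ℝ ξ (x - y)).HasTemperateGrowth := by
    have h0 : (fun y : Conf n => 2 * inner ℝ ξ (x - y)) =
        fun y => 2 * inner ℝ ξ x - 2 * inner ℝ ξ y := by
      funext y; rw [inner_sub_right]; ring
    rw [h0]
    fun_prop
  exact hasTemperateGrowth_expI.comp h

theorem hasTemperateGrowth_reflect (x : Conf n) :
    (fun y : Conf n => (2 : ℝ) • x - y).HasTemperateGrowth := by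
  fun_prop

/-- The Schwartz function `y ↦ e^{2iξ·(x - y)} conj (v(2x - y))`: the transpose of the
Grossmann-Royer operator `T_GR(z) u(y) = e^{2iξ·(y - x)} u(2x - y)`, applied to `conj v`. -/
def royerTest (z : Phase n) (v : 𝓢(Conf n, ℂ)) : 𝓢(Conf n, ℂ) :=
  SchwartzMap.smulLeftCLM ℂ (fun y : Conf n => exp (I * (2 * inner ℝ (mom z) (pos z - y) : ℝ)))
    (SchwartzMap.compCLMOfAntilipschitz (K := 1) ℝ (hasTemperateGrowth_reflect (pos z))
      (fun a b => by simp [edist_dist, dist_eq_norm, norm_sub_rev])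
      (v.postcompCLM (conjCLE : ℂ →L[ℝ] ℂ)))

theorem royerTest_apply (z : Phase n) (v : 𝓢(Conf n, ℂ)) (y : Conf n) :
    royerTest z v y = exp (I * (2 * inner ℝ (mom z) (pos z - y) : ℝ)) *
      conj (v ((2 : ℝ) • pos z - y)) := by
  rw [royerTest, SchwartzMap.smulLeftCLM_apply_apply (hasTemperateGrowth_phase _ _)]
  rfl

/-- The cross-Wigner transform `W(u, v)(z) = π^{-n} ⟨T_GR(z) u, conj v⟩` of a tempered
distribution `u` and a Schwartz function `v`. -/
def crossWignerDist (u : 𝓢'(Conf n, ℂ)) (v : 𝓢(Conf n, ℂ)) (z : Phase n) : ℂ :=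
  (1 / Real.pi : ℂ) ^ n * u (royerTest z v)

/-- `W_{f,φ} u = M_f⁻¹ W_φ u` with `W_φ u = (2π)^{n/2} W(u, φ)`, for a tempered distribution `u`
and a Schwartz function `φ`. -/
def wavepacketMapDist (f : PhaseAut n) (φ : 𝓢(Conf n, ℂ)) (u : 𝓢'(Conf n, ℂ)) : Phase n → ℂ :=
  (opM f).symm fun z => wNorm n * crossWignerDist u φ z

/-- The continuous linear operator `T'` on tempered distributions extends the operator `T`
on `L²(ℝⁿ)`. -/
def ExtendsL2 (T : UnitaryOp n) (T' : 𝓢'(Conf n, ℂ) →L[ℂ] 𝓢'(Conf n, ℂ)) : Prop :=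
  ∀ u : L2 n, T' (Lp.toTemperedDistribution u) = Lp.toTemperedDistribution (T u)

end PhaseSpaceWeyl

end

/-!
The proof rests on the Grossmann-Royer operators `R(z) u(y) = e^{2iξ·(y - x)} u(2x - y)`,
`z = (x, ξ)`, which are unitary on `L²(ℝⁿ)`. The substitution `y ↦ x - y/2` turns the cross-Wigner
transform into a matrix coefficient, `W(u, v)(z) = π^{-n} ⟨v, R(z) u⟩` (`crossWigner_eq_inner`). For
a unitary operator `T`, the covariance `W(T u, T v)(S z) = W(u, v)(z)` is therefore a consequence of
the intertwining relation `T R(z) = R(S z) T`. Together with the fact that `T` restricts to a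
topological automorphism of `𝓢(ℝⁿ)`, this relation defines `IsCovariant T S`. It is stable under
products and inverses of pairs `(T, S)`, so it only has to be proved for the generators of the
metaplectic group, where it suffices to compare two explicit Schwartz functions
(`isCovariant_of_schwartz`).

The projection is onto `Sp(2n, σ)` (`mem_mpImage`). A symplectic matrix whose upper left block is
invertible is a product of a lower shear, a block diagonal matrix and an upper shear, and an upper
shear is conjugate to a lower one by `J`. The general case reduces to this one by right
multiplication by the lower shear of `t I`, which changes the upper left block `A` into `A + t B`:
this is invertible for some real `t`, because the polynomial `det (A + t B)` does not vanish at
`t = i` (`exists_isUnit_add_smul`). Plancherel's theorem and the change of variables formula provide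
unitary operators above each of the matrices used.

On tempered distributions, the transpose of `φ ↦ conj (T⁻¹ (conj φ))` extends `T`. Since `L²(ℝⁿ)` is
dense in `𝓢'(ℝⁿ)` (`functional_eq_zero_of_L2`), and both sides of the covariance relation are
continuous in `u` at each point of phase space, the identity on `𝓢'(ℝⁿ)`, for every continuous
extension of `T`, follows from the identity on `L²(ℝⁿ)`.

If `f^* ω = f'^* ω = σ`, then `S = f⁻¹ f'` preserves `σ`, hence `det S = 1`, and the covariance
relation for `S` is the equality of `M_{f'}⁻¹ W_φ u` and `M_f⁻¹ W_{T φ} (T u)`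
(`opM_symm_eq_opM_symm`).
-/

noncomputable section

namespace PhaseSpaceWeyl

variable {n : ℕ}

/-! ### Weighted composition operators -/

/-- The data of a unitary weighted composition operator `u ↦ c · (u ∘ g)`: the map `g`
multiplies volumes by `κ`, and the weight `c` has the constant modulus `√κ`. -/
structure IsUnitaryWeight (c : Conf n → ℂ) (g : Conf n ≃ₜ Conf n) (κ : ℝ) : Prop where
  pos : 0 < κ
  continuous : Continuous c
  norm_eq : ∀ x, ‖c x‖ = √κ
  map_eq : (volume : Measure (Conf n)).map g = ENNReal.ofReal κ⁻¹ • volume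

namespace IsUnitaryWeight

variable {c : Conf n → ℂ} {g : Conf n ≃ₜ Conf n} {κ : ℝ}

/-- The inverse of `u ↦ c · (u ∘ g)` is again a weighted composition operator. -/
theorem symm (h : IsUnitaryWeight c g κ) :
    IsUnitaryWeight (fun x => (c (g.symm x))⁻¹) g.symm κ⁻¹ where
  pos := inv_pos.2 h.pos
  continuous := (h.continuous.comp g.symm.continuous).inv₀ fun x hx => by
    have := h.norm_eq (g.symm x)
    simp only [Function.comp_apply] at hx
    rw [hx, norm_zero] at this
    exact (Real.sqrt_pos.2 h.pos).ne this
  norm_eq x := by rw [norm_inv, h.norm_eq, Real.sqrt_inv]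
  map_eq := by
    have h1 : ((volume : Measure (Conf n)).map g).map g.symm = volume := by
      rw [Measure.map_map g.symm.measurable g.measurable]
      simp
    have h2 : ENNReal.ofReal κ * ENNReal.ofReal κ⁻¹ = 1 := by
      rw [← ENNReal.ofReal_mul h.pos.le, mul_inv_cancel₀ h.pos.ne', ENNReal.ofReal_one]
    rw [h.map_eq, Measure.map_smul] at h1
    calc _ = (ENNReal.ofReal κ * ENNReal.ofReal κ⁻¹) • Measure.map g.symm volume := by
          rw [h2, one_smul]
      _ = _ := by rw [mul_smul, h1, inv_inv]

theorem quasiMeasurePreserving (h : IsUnitaryWeight c g κ) :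
    Measure.QuasiMeasurePreserving g (volume : Measure (Conf n)) volume :=
  ⟨g.measurable, by rw [h.map_eq]; exact Measure.smul_absolutelyContinuous⟩

theorem eLpNorm_eq (h : IsUnitaryWeight c g κ) {u : Conf n → ℂ}
    (hu : AEStronglyMeasurable u volume) :
    eLpNorm (fun x => c x * u (g x)) 2 volume = eLpNorm u 2 volume := by
  have h1 : eLpNorm (fun x => c x * u (g x)) 2 volume =
      eLpNorm ((√κ : ℝ) • (u ∘ g)) 2 volume := by
    refine eLpNorm_congr_norm_ae (.of_forall fun x => ?_)
    simp [h.norm_eq, abs_of_nonneg (Real.sqrt_nonneg κ)]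
  have hu' : AEStronglyMeasurable u ((volume : Measure (Conf n)).map g) := by
    rw [h.map_eq]
    exact hu.mono_ac Measure.smul_absolutelyContinuous
  have h2 : eLpNorm (u ∘ g) 2 volume = ENNReal.ofReal (√κ)⁻¹ * eLpNorm u 2 volume := by
    rw [← eLpNorm_map_measure hu' g.measurable.aemeasurable, h.map_eq,
      eLpNorm_smul_measure_of_ne_top (by norm_num), smul_eq_mul,
      ENNReal.ofReal_rpow_of_nonneg (inv_pos.2 h.pos).le (by positivity)]
    congr 2
    rw [← Real.sqrt_inv, Real.sqrt_eq_rpow]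
    norm_num
  rw [h1, eLpNorm_const_smul, h2, ← mul_assoc, Real.enorm_eq_ofReal (Real.sqrt_nonneg κ),
    ← ENNReal.ofReal_mul (Real.sqrt_nonneg κ), mul_inv_cancel₀ (Real.sqrt_pos.2 h.pos).ne',
    ENNReal.ofReal_one, one_mul]

theorem memLp (h : IsUnitaryWeight c g κ) {u : Conf n → ℂ} (hu : MemLp u 2 volume) :
    MemLp (fun x => c x * u (g x)) 2 volume :=
  ⟨h.continuous.aestronglyMeasurable.mul
    (hu.aestronglyMeasurable.comp_quasiMeasurePreserving h.quasiMeasurePreserving),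
    by rw [h.eLpNorm_eq hu.aestronglyMeasurable]; exact hu.2⟩

/-- The isometry `u ↦ c · (u ∘ g)` of `L²(ℝⁿ)`. -/
def toIsometry (h : IsUnitaryWeight c g κ) : L2 n →ₗᵢ[ℂ] L2 n where
  toFun u := (h.memLp (Lp.memLp u)).toLp _
  map_add' u v := by
    refine Lp.ext ?_
    filter_upwards [MemLp.coeFn_toLp (h.memLp (Lp.memLp (u + v))),
      MemLp.coeFn_toLp (h.memLp (Lp.memLp u)), MemLp.coeFn_toLp (h.memLp (Lp.memLp v)),
      Lp.coeFn_add ((h.memLp (Lp.memLp u)).toLp _) ((h.memLp (Lp.memLp v)).toLp _),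
      h.quasiMeasurePreserving.ae_eq_comp (Lp.coeFn_add u v)] with x h1 h2 h3 h4 h5
    simp only [Function.comp_apply, Pi.add_apply] at h5 h4
    rw [h1, h4, h2, h3, h5, mul_add]
  map_smul' a u := by
    refine Lp.ext ?_
    filter_upwards [MemLp.coeFn_toLp (h.memLp (Lp.memLp (a • u))),
      MemLp.coeFn_toLp (h.memLp (Lp.memLp u)),
      Lp.coeFn_smul a ((h.memLp (Lp.memLp u)).toLp _),
      h.quasiMeasurePreserving.ae_eq_comp (Lp.coeFn_smul a u)] with x h1 h2 h4 h5
    simp only [Function.comp_apply, Pi.smul_apply, RingHom.id_apply, smul_eq_mul] at h5 h4 ⊢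
    rw [h1, h4, h2, h5, mul_left_comm]
  norm_map' u := by
    simp only [LinearMap.coe_mk, AddHom.coe_mk]
    rw [Lp.norm_toLp, h.eLpNorm_eq (Lp.aestronglyMeasurable u), Lp.norm_def]

theorem toIsometry_ae (h : IsUnitaryWeight c g κ) (u : L2 n) :
    h.toIsometry u =ᵐ[volume] fun x => c x * u (g x) :=
  MemLp.coeFn_toLp (h.memLp (Lp.memLp u))

theorem toIsometry_surjective (h : IsUnitaryWeight c g κ) : Function.Surjective h.toIsometry := by
  intro v
  refine ⟨h.symm.toIsometry v, Lp.ext ?_⟩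
  filter_upwards [h.toIsometry_ae (h.symm.toIsometry v),
    h.quasiMeasurePreserving.ae_eq_comp (h.symm.toIsometry_ae v)] with x h1 h2
  have hc : c x ≠ 0 := norm_pos_iff.1 (by rw [h.norm_eq]; exact Real.sqrt_pos.2 h.pos)
  simp only [Function.comp_apply, Homeomorph.symm_apply_apply] at h2
  rw [h1, h2, mul_inv_cancel_left₀ hc]

/-- The unitary operator `u ↦ c · (u ∘ g)` on `L²(ℝⁿ)`. -/
def toUnitary (h : IsUnitaryWeight c g κ) : UnitaryOp n :=
  LinearIsometryEquiv.ofSurjective h.toIsometry h.toIsometry_surjective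

theorem toUnitary_ae (h : IsUnitaryWeight c g κ) (u : L2 n) :
    h.toUnitary u =ᵐ[volume] fun x => c x * u (g x) :=
  h.toIsometry_ae u

end IsUnitaryWeight

/-- The linear automorphism of `ℝⁿ` with matrix `L`. -/
def linAut (L : GL (Fin n) ℝ) : Conf n ≃L[ℝ] Conf n :=
  ContinuousLinearEquiv.equivOfInverse (Matrix.toEuclideanCLM (𝕜 := ℝ) L.1)
    (Matrix.toEuclideanCLM (𝕜 := ℝ) (L⁻¹).1)
    (fun x => by
      rw [← mul_apply_eq_comp, ← map_mul, Units.inv_mul, map_one]; rfl)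
    (fun x => by
      rw [← mul_apply_eq_comp, ← map_mul, Units.mul_inv, map_one]; rfl)

theorem linAut_apply (L : GL (Fin n) ℝ) (x : Conf n) :
    linAut L x = WithLp.toLp 2 (L.1 *ᵥ x.ofLp) := rfl

theorem linAut_inv_apply_linAut (L : GL (Fin n) ℝ) (x : Conf n) :
    linAut L⁻¹ (linAut L x) = x := by
  ext i; simp [linAut_apply]

theorem linAut_apply_linAut_inv (L : GL (Fin n) ℝ) (x : Conf n) :
    linAut L (linAut L⁻¹ x) = x := by
  ext i; simp [linAut_apply]

theorem map_linAut_volume (L : GL (Fin n) ℝ) :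
    (volume : Measure (Conf n)).map (linAut L) = ENNReal.ofReal |L.1.det|⁻¹ • volume := by
  have hdet : LinearMap.det (Matrix.toEuclideanLin (𝕜 := ℝ) L.1) = L.1.det := by
    rw [Matrix.toEuclideanLin_eq_toLin_orthonormal, LinearMap.det_toLin]
  have h0 : LinearMap.det (Matrix.toEuclideanLin (𝕜 := ℝ) L.1) ≠ 0 := by
    rw [hdet]; exact ((Matrix.isUnit_iff_isUnit_det _).1 L.isUnit).ne_zero
  have := Measure.map_linearMap_addHaar_eq_smul_addHaar (volume : Measure (Conf n)) h0
  rw [hdet, abs_inv] at this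
  exact this

theorem isUnitaryWeight_linAut (L : GL (Fin n) ℝ) (a : ℂ) (ha : ‖a‖ = 1) :
    IsUnitaryWeight (fun _ => a * ((√|L.1.det| : ℝ) : ℂ)) (linAut L).toHomeomorph |L.1.det| where
  pos := abs_pos.2 ((Matrix.isUnit_iff_isUnit_det _).1 L.isUnit).ne_zero
  continuous := continuous_const
  norm_eq x := by simp [ha, abs_of_nonneg (Real.sqrt_nonneg _)]
  map_eq := map_linAut_volume L

theorem isUnitaryWeight_refl (c : Conf n → ℂ) (hc : Continuous c) (h1 : ∀ x, ‖c x‖ = 1) :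
    IsUnitaryWeight c (Homeomorph.refl _) 1 where
  pos := one_pos
  continuous := hc
  norm_eq x := by simp [h1]
  map_eq := by simp

theorem isUnitaryWeight_reflect (c : Conf n → ℂ) (hc : Continuous c) (h1 : ∀ x, ‖c x‖ = 1)
    (a : Conf n) : IsUnitaryWeight c (Homeomorph.subLeft a) 1 where
  pos := one_pos
  continuous := hc
  norm_eq x := by simp [h1]
  map_eq := by
    simpa using (Measure.measurePreserving_sub_left (volume : Measure (Conf n)) a).map_eq

/-! ### Grossmann-Royer operators and the cross-Wigner transform -/

/-- The phase `y ↦ e^{2iξ·(y - x)}` of the Grossmann-Royer operator at `z = (x, ξ)`. -/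
def royerPhase (z : Phase n) (y : Conf n) : ℂ :=
  exp (I * (2 * inner ℝ (mom z) (y - pos z) : ℝ))

theorem isUnitaryWeight_royer (z : Phase n) :
    IsUnitaryWeight (royerPhase z) (Homeomorph.subLeft ((2 : ℝ) • pos z)) 1 :=
  isUnitaryWeight_reflect _ (by unfold royerPhase; fun_prop)
    (fun y => by rw [royerPhase, mul_comm, norm_exp_ofReal_mul_I]) _

/-- The Grossmann-Royer operator `u ↦ e^{2iξ·(y - x)} u(2x - y)` at `z = (x, ξ)`, acting on
`L²(ℝⁿ)`. -/
def royerOp (z : Phase n) : UnitaryOp n := (isUnitaryWeight_royer z).toUnitary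

theorem royerOp_ae (z : Phase n) (u : L2 n) :
    royerOp z u =ᵐ[volume] fun y => royerPhase z y * u ((2 : ℝ) • pos z - y) :=
  (isUnitaryWeight_royer z).toUnitary_ae u

theorem crossWigner_eq_integral_royerPhase (u v : Conf n → ℂ) (z : Phase n) :
    crossWigner u v z = (1 / Real.pi : ℂ) ^ n *
      ∫ y, royerPhase z y * u ((2 : ℝ) • pos z - y) * conj (v y) := by
  set F : Conf n → ℂ := fun y => royerPhase z y * u ((2 : ℝ) • pos z - y) * conj (v y)
  have h1 : ∫ y : Conf n, exp (-(I * (inner ℝ (mom z) y : ℝ))) *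
      u (pos z + (1 / 2 : ℝ) • y) * conj (v (pos z - (1 / 2 : ℝ) • y)) =
      ∫ y, F (pos z - (1 / 2 : ℝ) • y) := by
    refine integral_congr_ae (.of_forall fun y => ?_)
    simp only [F, royerPhase]
    congr 3
    · rw [sub_sub_cancel_left, inner_neg_right, inner_smul_right]
      push_cast
      ring
    · module
  rw [crossWigner, h1,
    Measure.integral_comp_smul volume (fun y => F (pos z - y)) (1 / 2 : ℝ),
    integral_sub_left_eq_self F volume (pos z)]
  rw [← smul_eq_mul, ← smul_eq_mul, ← Complex.coe_smul, smul_smul]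
  congr 1
  rw [finrank_euclideanSpace_fin, abs_of_pos (by positivity)]
  push_cast
  rw [← inv_pow, ← mul_pow]
  congr 1
  field_simp
  rw [smul_eq_mul]

theorem crossWigner_congr_ae {u u' v v' : Conf n → ℂ} (hu : u =ᵐ[volume] u')
    (hv : v =ᵐ[volume] v') (z : Phase n) : crossWigner u v z = crossWigner u' v' z := by
  rw [crossWigner_eq_integral_royerPhase, crossWigner_eq_integral_royerPhase]
  congr 1
  refine integral_congr_ae ?_
  filter_upwards [hv, (isUnitaryWeight_royer z).quasiMeasurePreserving.ae_eq_comp hu] with y h1 h2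
  simp only [Function.comp_apply, Homeomorph.coe_subLeft] at h2
  rw [h1, h2]

/-- The cross-Wigner transform is a matrix coefficient of the Grossmann-Royer operators. -/
theorem crossWigner_eq_inner (u v : L2 n) (z : Phase n) :
    crossWigner u v z = (1 / Real.pi : ℂ) ^ n * inner ℂ v (royerOp z u) := by
  rw [crossWigner_eq_integral_royerPhase, L2.inner_def]
  congr 1
  refine integral_congr_ae ?_
  filter_upwards [royerOp_ae z u] with y h
  simp [h]

/-- Complex conjugation of Schwartz functions. -/
def conjSchwartz : 𝓢(Conf n, ℂ) →L[ℝ] 𝓢(Conf n, ℂ) :=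
  SchwartzMap.postcompCLM (conjCLE : ℂ →L[ℝ] ℂ)

@[simp]
theorem conjSchwartz_apply (φ : 𝓢(Conf n, ℂ)) (y : Conf n) : conjSchwartz φ y = conj (φ y) := rfl

/-- The Grossmann-Royer operator at `z`, acting on `𝓢(ℝⁿ)`. -/
def royerSchwartz (z : Phase n) (φ : 𝓢(Conf n, ℂ)) : 𝓢(Conf n, ℂ) :=
  conjSchwartz (royerTest z φ)

theorem royerSchwartz_apply (z : Phase n) (φ : 𝓢(Conf n, ℂ)) (y : Conf n) :
    royerSchwartz z φ y = royerPhase z y * φ ((2 : ℝ) • pos z - y) := by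
  rw [royerSchwartz, conjSchwartz_apply, royerTest_apply, map_mul, conj_conj, royerPhase,
    ← exp_conj, map_mul, conj_I, conj_ofReal]
  congr 2
  rw [← neg_sub y, inner_neg_right]
  push_cast
  ring

theorem royerOp_toLp (z : Phase n) (φ : 𝓢(Conf n, ℂ)) :
    royerOp z (φ.toLp 2) = (royerSchwartz z φ).toLp 2 := by
  refine Lp.ext ?_
  filter_upwards [royerOp_ae z (φ.toLp 2), (royerSchwartz z φ).coeFn_toLp 2 volume,
    (isUnitaryWeight_royer z).quasiMeasurePreserving.ae_eq_comp (φ.coeFn_toLp 2 volume)]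
    with y h1 h2 h3
  simp only [Function.comp_apply, Homeomorph.coe_subLeft] at h3
  rw [h1, h2, royerSchwartz_apply, h3]

theorem crossWignerDist_toTemperedDistribution (u : L2 n) (v : 𝓢(Conf n, ℂ)) (z : Phase n) :
    crossWignerDist (Lp.toTemperedDistribution u) v z = crossWigner u v z := by
  rw [crossWigner_eq_integral_royerPhase, crossWignerDist, Lp.toTemperedDistribution_apply,
    ← integral_sub_left_eq_self _ volume ((2 : ℝ) • pos z)]
  congr 2
  funext y
  have hy : pos z - ((2 : ℝ) • pos z - y) = y - pos z := by module
  rw [royerTest_apply, royerPhase, sub_sub_cancel, hy, smul_eq_mul, mul_right_comm]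

/-! ### Symplectic covariance of the metaplectic generators -/

theorem pos_fromBlocks_mulVec (A B C D : Matrix (Fin n) (Fin n) ℝ) (z : Phase n) :
    pos (Matrix.fromBlocks A B C D *ᵥ z) =
      WithLp.toLp 2 (A *ᵥ (pos z).ofLp + B *ᵥ (mom z).ofLp) := by
  rw [Matrix.fromBlocks_mulVec]; rfl

theorem mom_fromBlocks_mulVec (A B C D : Matrix (Fin n) (Fin n) ℝ) (z : Phase n) :
    mom (Matrix.fromBlocks A B C D *ᵥ z) =
      WithLp.toLp 2 (C *ᵥ (pos z).ofLp + D *ᵥ (mom z).ofLp) := by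
  rw [Matrix.fromBlocks_mulVec]; rfl

/-- The unitary operator `T` on `L²(ℝⁿ)` restricts to a topological automorphism of `𝓢(ℝⁿ)`, and
conjugation by `T` moves the Grossmann-Royer operator at `z` to the one at `S z`. -/
def IsCovariant (T : UnitaryOp n) (S : Sp n) : Prop :=
  (∃ A : 𝓢(Conf n, ℂ) ≃L[ℂ] 𝓢(Conf n, ℂ), ∀ φ, (A φ).toLp 2 = T (φ.toLp 2)) ∧
    ∀ (z : Phase n) (u : L2 n), T (royerOp z u) = royerOp ((S : PhaseMatrix n) *ᵥ z) (T u)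

/-- Covariance can be checked on Schwartz functions, which are dense in `L²(ℝⁿ)`. -/
theorem isCovariant_of_schwartz {T : UnitaryOp n} {S : Sp n}
    (A : 𝓢(Conf n, ℂ) ≃L[ℂ] 𝓢(Conf n, ℂ)) (hA : ∀ φ, (A φ).toLp 2 = T (φ.toLp 2))
    (hS : ∀ z φ y, A (royerSchwartz z φ) y =
      royerSchwartz ((S : PhaseMatrix n) *ᵥ z) (A φ) y) : IsCovariant T S := by
  refine ⟨⟨A, hA⟩, fun z u => ?_⟩
  refine (SchwartzMap.denseRange_toLpCLM (E := Conf n) (F := ℂ) (p := 2)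
    (μ := volume) (by norm_num)).induction_on
    (p := fun u => T (royerOp z u) = royerOp ((S : PhaseMatrix n) *ᵥ z) (T u)) u
    (isClosed_eq (by fun_prop) (by fun_prop)) fun φ => ?_
  rw [SchwartzMap.toLpCLM_apply, royerOp_toLp, ← hA, ← hA, royerOp_toLp]
  congr 1
  ext y
  exact hS z φ y

theorem isCovariant_one : IsCovariant (1 : UnitaryOp n) 1 :=
  isCovariant_of_schwartz (.refl ℂ _) (fun _ => rfl) (by simp)

theorem IsCovariant.mul {T T' : UnitaryOp n} {S S' : Sp n} (h : IsCovariant T S)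
    (h' : IsCovariant T' S') : IsCovariant (T * T') (S * S') := by
  obtain ⟨⟨A, hA⟩, hS⟩ := h
  obtain ⟨⟨A', hA'⟩, hS'⟩ := h'
  refine ⟨⟨A'.trans A, fun φ => ?_⟩, fun z u => ?_⟩
  · rw [ContinuousLinearEquiv.trans_apply, hA, hA']; rfl
  · change T (T' (royerOp z u)) = _
    rw [hS', hS, Matrix.mulVec_mulVec]
    rfl

theorem IsCovariant.inv {T : UnitaryOp n} {S : Sp n} (h : IsCovariant T S) :
    IsCovariant T⁻¹ S⁻¹ := by
  obtain ⟨⟨A, hA⟩, hS⟩ := h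
  refine ⟨⟨A.symm, fun φ => ?_⟩, fun z u => ?_⟩
  · refine T.injective ?_
    rw [← hA, A.apply_symm_apply]
    exact (T.apply_symm_apply _).symm
  · refine T.injective ?_
    have h1 : ∀ v, T (T⁻¹ v) = v := T.apply_symm_apply
    rw [h1, hS, h1, Matrix.mulVec_mulVec, ← Submonoid.coe_mul, mul_inv_cancel]
    simp

/-- Multiplication of Schwartz functions by a function `c` of temperate growth whose inverse `c'` is
of temperate growth too. -/
def mulSchwartz (c c' : Conf n → ℂ) (hc : c.HasTemperateGrowth) (hc' : c'.HasTemperateGrowth)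
    (h : ∀ x, c x * c' x = 1) : 𝓢(Conf n, ℂ) ≃L[ℂ] 𝓢(Conf n, ℂ) :=
  ContinuousLinearEquiv.equivOfInverse (SchwartzMap.smulLeftCLM ℂ c) (SchwartzMap.smulLeftCLM ℂ c')
    (fun φ => by
      ext x
      rw [SchwartzMap.smulLeftCLM_apply_apply hc', SchwartzMap.smulLeftCLM_apply_apply hc,
        smul_smul, mul_comm, h, one_smul])
    (fun φ => by
      ext x
      rw [SchwartzMap.smulLeftCLM_apply_apply hc, SchwartzMap.smulLeftCLM_apply_apply hc',
        smul_smul, h, one_smul])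

theorem mulSchwartz_apply (c c' : Conf n → ℂ) (hc : c.HasTemperateGrowth)
    (hc' : c'.HasTemperateGrowth) (h : ∀ x, c x * c' x = 1) (φ : 𝓢(Conf n, ℂ)) (x : Conf n) :
    mulSchwartz c c' hc hc' h φ x = c x * φ x :=
  SchwartzMap.smulLeftCLM_apply_apply hc φ x

/-- Multiplication of Schwartz functions by a non-zero constant. -/
def constMulSchwartz (a : ℂ) (ha : a ≠ 0) : 𝓢(Conf n, ℂ) ≃L[ℂ] 𝓢(Conf n, ℂ) :=
  mulSchwartz (fun _ => a) (fun _ => a⁻¹) (by fun_prop) (by fun_prop) (fun _ => mul_inv_cancel₀ ha)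

/-- Composition of Schwartz functions with the linear automorphism of matrix `L`. -/
def compSchwartz (L : GL (Fin n) ℝ) : 𝓢(Conf n, ℂ) ≃L[ℂ] 𝓢(Conf n, ℂ) :=
  ContinuousLinearEquiv.equivOfInverse (SchwartzMap.compCLMOfContinuousLinearEquiv ℂ (linAut L))
    (SchwartzMap.compCLMOfContinuousLinearEquiv ℂ (linAut L⁻¹))
    (fun φ => by
      ext x
      exact congrArg φ (linAut_apply_linAut_inv L x))
    (fun φ => by
      ext x
      exact congrArg φ (linAut_inv_apply_linAut L x))

/-- The quadratic form `x ↦ P x · x`. -/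
def quadForm (P : Matrix (Fin n) (Fin n) ℝ) (x : Conf n) : ℝ := x.ofLp ⬝ᵥ (P *ᵥ x.ofLp)

theorem quadForm_eq_inner (P : Matrix (Fin n) (Fin n) ℝ) (x : Conf n) :
    quadForm P x = inner ℝ x (Matrix.toEuclideanCLM (𝕜 := ℝ) P x) :=
  (Matrix.inner_toEuclideanCLM P x x).symm

/-- The chirp `x ↦ e^{(i/2) P x·x}`. -/
def chirpFun (P : Matrix (Fin n) (Fin n) ℝ) (x : Conf n) : ℂ :=
  exp (I / 2 * ((quadForm P x : ℝ) : ℂ))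

theorem chirpFun_eq (P : Matrix (Fin n) (Fin n) ℝ) (x : Conf n) :
    chirpFun P x = exp (I * ((2⁻¹ * quadForm P x : ℝ) : ℂ)) := by
  rw [chirpFun]
  congr 1
  push_cast
  ring

theorem hasTemperateGrowth_chirpFun (P : Matrix (Fin n) (Fin n) ℝ) :
    (chirpFun P).HasTemperateGrowth := by
  have h : (fun x : Conf n => 2⁻¹ * quadForm P x).HasTemperateGrowth := by
    simp only [quadForm_eq_inner]
    exact (Function.HasTemperateGrowth.const _).mul
      ((innerSL ℝ).bilinear_hasTemperateGrowth (𝕜 := ℝ) .id'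
        (ContinuousLinearMap.hasTemperateGrowth _))
  have := hasTemperateGrowth_expI.comp h
  exact (funext (chirpFun_eq P) : chirpFun P = _) ▸ this

theorem chirpFun_mul_chirpFun_neg (P : Matrix (Fin n) (Fin n) ℝ) (x : Conf n) :
    chirpFun P x * chirpFun (-P) x = 1 := by
  rw [chirpFun, chirpFun, ← exp_add, ← mul_add, ← ofReal_add]
  simp [quadForm, Matrix.neg_mulVec]

theorem norm_chirpFun (P : Matrix (Fin n) (Fin n) ℝ) (x : Conf n) : ‖chirpFun P x‖ = 1 := by
  rw [chirpFun_eq, mul_comm, norm_exp_ofReal_mul_I]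

theorem isCovariant_scaling {L : GL (Fin n) ℝ} {a : ℂ} (ha : a ≠ 0) {T : UnitaryOp n} {S : Sp n}
    (hT : ∀ u : L2 n, (T u : Conf n → ℂ) =ᵐ[volume] fun x =>
        a * ((√|L.1.det| : ℝ) : ℂ) * u (WithLp.toLp 2 (L.1 *ᵥ x.ofLp)))
    (hS : (S : PhaseMatrix n) = Matrix.fromBlocks (L⁻¹).1 0 0 (L.1)ᵀ) : IsCovariant T S := by
  have hdet : L.1.det ≠ 0 := ((Matrix.isUnit_iff_isUnit_det _).1 L.isUnit).ne_zero
  have hc : a * ((√|L.1.det| : ℝ) : ℂ) ≠ 0 :=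
    mul_ne_zero ha (ofReal_ne_zero.2 (Real.sqrt_pos.2 (abs_pos.2 hdet)).ne')
  have hval (φ : 𝓢(Conf n, ℂ)) (x : Conf n) :
      ((compSchwartz L).trans (constMulSchwartz _ hc)) φ x =
        a * ((√|L.1.det| : ℝ) : ℂ) * φ (linAut L x) := mulSchwartz_apply ..
  refine isCovariant_of_schwartz ((compSchwartz L).trans (constMulSchwartz _ hc))
    (fun φ => Lp.ext ?_) fun z φ y => ?_
  · have hq := (isUnitaryWeight_linAut L 1 (by simp)).quasiMeasurePreserving
    filter_upwards [hT (φ.toLp 2), SchwartzMap.coeFn_toLp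
      (((compSchwartz L).trans (constMulSchwartz _ hc)) φ) 2 volume,
      hq.ae_eq_comp (φ.coeFn_toLp 2 volume)] with x h1 h2 h3
    rw [h1, h2, hval]
    exact congrArg _ h3.symm
  · have hpos : pos ((S : PhaseMatrix n) *ᵥ z) = linAut L⁻¹ (pos z) := by
      rw [hS, pos_fromBlocks_mulVec, linAut_apply]; simp
    have hmom (w : Conf n) : inner ℝ (mom ((S : PhaseMatrix n) *ᵥ z)) w =
        inner ℝ (mom z) (linAut L w) := by
      rw [hS, mom_fromBlocks_mulVec, linAut_apply]
      simp only [EuclideanSpace.inner_eq_star_dotProduct, Matrix.zero_mulVec, zero_add, star_trivial]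
      rw [Matrix.mulVec_transpose, dotProduct_comm, ← Matrix.dotProduct_mulVec, dotProduct_comm]
    rw [hval, royerSchwartz_apply, royerSchwartz_apply, hval, royerPhase, royerPhase, hmom, hpos]
    simp only [map_sub, map_smul, linAut_apply_linAut_inv]
    ring

/-- Since `½ (P y·y - P(2x - y)·(2x - y)) = 2 P x·(y - x)`, a chirp adds `P x` to the frequency of
the Grossmann-Royer operator at `z = (x, ξ)`. -/
theorem isCovariant_chirp {P : Matrix (Fin n) (Fin n) ℝ} (hP : P.IsSymm) {T : UnitaryOp n}
    {S : Sp n} (hT : ∀ u : L2 n, (T u : Conf n → ℂ) =ᵐ[volume] fun x => chirpFun P x * u x)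
    (hS : (S : PhaseMatrix n) = Matrix.fromBlocks 1 0 P 1) : IsCovariant T S := by
  refine isCovariant_of_schwartz (mulSchwartz (chirpFun P) (chirpFun (-P))
    (hasTemperateGrowth_chirpFun P) (hasTemperateGrowth_chirpFun (-P))
    (chirpFun_mul_chirpFun_neg P)) (fun φ => Lp.ext ?_) fun z φ y => ?_
  · filter_upwards [hT (φ.toLp 2), SchwartzMap.coeFn_toLp (mulSchwartz (chirpFun P) (chirpFun (-P))
      (hasTemperateGrowth_chirpFun P) (hasTemperateGrowth_chirpFun (-P))
      (chirpFun_mul_chirpFun_neg P) φ) 2 volume, φ.coeFn_toLp 2 volume] with x h1 h2 h3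
    rw [h1, h2, mulSchwartz_apply, h3]
  · set Q := Matrix.toEuclideanCLM (𝕜 := ℝ) P
    have hpos : pos ((S : PhaseMatrix n) *ᵥ z) = pos z := by
      rw [hS, pos_fromBlocks_mulVec]; simp
    have hmom : mom ((S : PhaseMatrix n) *ᵥ z) = Q (pos z) + mom z := by
      rw [hS, mom_fromBlocks_mulVec]; simp [Q]; rfl
    have hQ (v w : Conf n) : inner ℝ (Q v) w = inner ℝ v (Q w) := by
      rw [real_inner_comm, Matrix.inner_toEuclideanCLM, Matrix.inner_toEuclideanCLM,
        dotProduct_comm, ← Matrix.vecMul_transpose, hP.eq, Matrix.dotProduct_mulVec]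
    rw [mulSchwartz_apply, royerSchwartz_apply, royerSchwartz_apply, mulSchwartz_apply, royerPhase,
      royerPhase, hpos, hmom, chirpFun_eq, chirpFun_eq, ← mul_assoc, ← mul_assoc, ← exp_add,
      ← exp_add, ← mul_add, ← mul_add, ← ofReal_add, ← ofReal_add, quadForm_eq_inner,
      quadForm_eq_inner]
    congr 4
    have h1 : inner ℝ (pos z) (Q y) = inner ℝ y (Q (pos z)) := by
      rw [← hQ, real_inner_comm]
    simp only [inner_add_left, inner_sub_right, inner_sub_left, map_sub, map_smul,
      inner_smul_left, inner_smul_right, hQ, conj_trivial, Q] at h1 ⊢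
    linear_combination -h1

/-! ### The Fourier transform -/

/-- The function `x ↦ ∫ e^{-i x·y} u(y) dy`. -/
def plainFourier (u : Conf n → ℂ) (x : Conf n) : ℂ :=
  ∫ y : Conf n, exp (-(I * (inner ℝ x y : ℝ))) * u y

/-- The matrix `(2π)⁻¹ I`. -/
def invTwoPi (n : ℕ) : GL (Fin n) ℝ :=
  Units.map (Matrix.scalar (Fin n)).toMonoidHom
    (Units.mk0 (2 * Real.pi)⁻¹ (inv_ne_zero (by positivity)))

theorem linAut_invTwoPi (x : Conf n) : linAut (invTwoPi n) x = (2 * Real.pi)⁻¹ • x := by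
  ext i
  simp [linAut_apply, invTwoPi]

theorem sqrt_abs_det_invTwoPi : √|(invTwoPi n).1.det| = (√(2 * Real.pi))⁻¹ ^ n := by
  have h : (invTwoPi n).1.det = (2 * Real.pi)⁻¹ ^ n := by
    simp [invTwoPi]
  rw [h, abs_of_pos (by positivity), ← Real.sqrt_inv, Real.sqrt_eq_iff_mul_self_eq (by positivity)
    (by positivity), ← mul_pow, Real.mul_self_sqrt (by positivity)]

/-- The unnormalized Fourier transform is a rescaling of `𝓕`, whose kernel is `e^{-2πi x·y}`. -/
theorem fourier_linAut_invTwoPi (φ : 𝓢(Conf n, ℂ)) (x : Conf n) :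
    (FourierTransform.fourier φ : 𝓢(Conf n, ℂ)) (linAut (invTwoPi n) x) = plainFourier φ x := by
  rw [SchwartzMap.fourier_coe, Real.fourier_eq', linAut_invTwoPi, plainFourier]
  congr 1
  funext y
  rw [inner_smul_right, smul_eq_mul, real_inner_comm]
  congr 2
  push_cast
  have : (Real.pi : ℂ) ≠ 0 := ofReal_ne_zero.2 Real.pi_ne_zero
  field_simp

/-- The constant `(2πi)^{-n/2}` of the metaplectic Fourier transform. -/
def fourierConst (n : ℕ) : ℂ :=
  exp (-(I * n * Real.pi / 4)) * (((√(2 * Real.pi))⁻¹ ^ n : ℝ) : ℂ)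

theorem fourierConst_ne_zero : fourierConst n ≠ 0 :=
  mul_ne_zero (exp_ne_zero _) (ofReal_ne_zero.2 (by positivity))

/-- The metaplectic Fourier transform on `𝓢(ℝⁿ)`. -/
def fourierSchwartz (n : ℕ) : 𝓢(Conf n, ℂ) ≃L[ℂ] 𝓢(Conf n, ℂ) :=
  ((FourierTransform.fourierCLE ℂ 𝓢(Conf n, ℂ)).trans (compSchwartz (invTwoPi n))).trans
    (constMulSchwartz (fourierConst n) fourierConst_ne_zero)

theorem fourierSchwartz_apply (φ : 𝓢(Conf n, ℂ)) (x : Conf n) :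
    fourierSchwartz n φ x = fourierConst n * plainFourier φ x := by
  rw [← fourier_linAut_invTwoPi]
  exact mulSchwartz_apply ..

/-- The Fourier transform turns the reflection and modulation of a Grossmann-Royer operator into
those of another one. -/
theorem plainFourier_royerSchwartz (z : Phase n) (φ : 𝓢(Conf n, ℂ)) (k : Conf n) :
    plainFourier (royerSchwartz z φ) k =
      exp (I * (2 * inner ℝ (-pos z) (k - mom z) : ℝ)) *
        plainFourier φ ((2 : ℝ) • mom z - k) := by
  rw [plainFourier, plainFourier, ← integral_const_mul,
    ← integral_sub_left_eq_self _ volume ((2 : ℝ) • pos z)]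
  congr 1
  funext y
  rw [royerSchwartz_apply, royerPhase, sub_sub_cancel, ← mul_assoc, ← mul_assoc, ← exp_add,
    ← exp_add]
  congr 2
  simp only [inner_sub_right, inner_sub_left, inner_neg_left, inner_smul_left, inner_smul_right,
    conj_trivial, real_inner_comm (pos z)]
  push_cast
  ring

theorem isCovariant_fourier {T : UnitaryOp n} {S : Sp n}
    (hT : ∀ u : 𝓢(Conf n, ℂ), (T (u.toLp 2) : Conf n → ℂ) =ᵐ[volume] fun x =>
      fourierConst n * plainFourier u x)
    (hS : (S : PhaseMatrix n) = Matrix.fromBlocks 0 1 (-1) 0) : IsCovariant T S := by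
  refine isCovariant_of_schwartz (fourierSchwartz n) (fun φ => Lp.ext ?_) fun z φ y => ?_
  · filter_upwards [hT φ, (fourierSchwartz n φ).coeFn_toLp 2 volume] with x h1 h2
    rw [h1, h2, fourierSchwartz_apply]
  · have hpos : pos ((S : PhaseMatrix n) *ᵥ z) = mom z := by
      rw [hS, pos_fromBlocks_mulVec]; simp
    have hmom : mom ((S : PhaseMatrix n) *ᵥ z) = -pos z := by
      rw [hS, mom_fromBlocks_mulVec]; simp [Matrix.neg_mulVec]
    rw [royerSchwartz_apply, fourierSchwartz_apply, fourierSchwartz_apply,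
      plainFourier_royerSchwartz, royerPhase, hpos, hmom, mul_left_comm]

theorem isCovariant_of_mpGenerator {T : UnitaryOp n} {S : Sp n} (h : MpGenerator T S) :
    IsCovariant T S := by
  cases h with
  | fourier _ _ hT hS => exact isCovariant_fourier hT hS
  | scaling L m hm _ _ hT hS => exact isCovariant_scaling (zpow_ne_zero m I_ne_zero) hT hS
  | chirp P hP _ _ hT hS => exact isCovariant_chirp hP hT hS

theorem isCovariant_of_mem_mpGraph {p : UnitaryOp n × Sp n} (h : p ∈ mpGraph n) :
    IsCovariant p.1 p.2 := by
  induction h using Subgroup.closure_induction with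
  | mem p hp => exact isCovariant_of_mpGenerator hp
  | one => exact isCovariant_one
  | mul p q _ _ hp hq => exact hp.mul hq
  | inv p _ hp => exact hp.inv

/-! ### Surjectivity of the metaplectic projection -/

/-- The metaplectic Fourier transform on `L²(ℝⁿ)`: Plancherel's unitary operator `𝓕` followed by the
unitary dilation by `(2π)⁻¹` and a constant phase. -/
theorem exists_mpGenerator_fourier {S : Sp n}
    (hS : (S : PhaseMatrix n) = Matrix.fromBlocks 0 1 (-1) 0) :
    ∃ T : UnitaryOp n, MpGenerator T S := by
  have hn : ‖exp (-(I * n * Real.pi / 4))‖ = 1 := by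
    rw [show -(I * n * Real.pi / 4) = ((-(n * Real.pi / 4) : ℝ) : ℂ) * I by push_cast; ring]
    exact norm_exp_ofReal_mul_I _
  have hw := isUnitaryWeight_linAut (invTwoPi n) _ hn
  refine ⟨(Lp.fourierTransformₗᵢ (Conf n) ℂ).trans hw.toUnitary, .fourier _ _ (fun u => ?_) hS⟩
  have h1 : (Lp.fourierTransformₗᵢ (Conf n) ℂ).trans hw.toUnitary (u.toLp 2) =
      hw.toUnitary ((FourierTransform.fourier u : 𝓢(Conf n, ℂ)).toLp 2) := by
    rw [← SchwartzMap.toLp_fourier_eq]; rfl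
  rw [h1]
  filter_upwards [hw.toUnitary_ae ((FourierTransform.fourier u : 𝓢(Conf n, ℂ)).toLp 2),
    hw.quasiMeasurePreserving.ae_eq_comp
      ((FourierTransform.fourier u : 𝓢(Conf n, ℂ)).coeFn_toLp 2 volume)] with x h2 h3
  rw [h2, sqrt_abs_det_invTwoPi]
  exact congrArg _ (h3.trans (fourier_linAut_invTwoPi u x))

theorem exists_mpGenerator_scaling (L : GL (Fin n) ℝ) {S : Sp n}
    (hS : (S : PhaseMatrix n) = Matrix.fromBlocks (L⁻¹).1 0 0 (L.1)ᵀ) :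
    ∃ T : UnitaryOp n, MpGenerator T S := by
  obtain ⟨m, hm⟩ : ∃ m : ℤ, Even m ↔ 0 < L.1.det := by
    by_cases h : 0 < L.1.det
    · exact ⟨0, by simp [h]⟩
    · exact ⟨1, by simp [h]⟩
  have hw := isUnitaryWeight_linAut L (I ^ m) (by simp)
  exact ⟨hw.toUnitary, .scaling L m hm _ _ hw.toUnitary_ae hS⟩

theorem exists_mpGenerator_chirp {P : Matrix (Fin n) (Fin n) ℝ} (hP : P.IsSymm) {S : Sp n}
    (hS : (S : PhaseMatrix n) = Matrix.fromBlocks 1 0 P 1) :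
    ∃ T : UnitaryOp n, MpGenerator T S := by
  have hw := isUnitaryWeight_refl (chirpFun P)
    (hasTemperateGrowth_chirpFun P).1.continuous (norm_chirpFun P)
  exact ⟨hw.toUnitary, .chirp P hP _ _ hw.toUnitary_ae hS⟩

open Polynomial in
/-- If the first block row `(A, B)` of a real matrix is that of a symplectic one, then `A + tB` is
invertible for some real `t`. -/
theorem exists_isUnit_add_smul {A B C D : Matrix (Fin n) (Fin n) ℝ} (h1 : A * Bᵀ = B * Aᵀ)
    (h2 : A * Dᵀ - B * Cᵀ = 1) : ∃ t : ℝ, IsUnit (A + t • B) := by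
  have hpd : IsUnit (A * Aᵀ + B * Bᵀ) := by
    refine Matrix.mulVec_injective_iff_isUnit.1 ((injective_iff_map_eq_zero
      (Matrix.mulVecLin (A * Aᵀ + B * Bᵀ))).2 fun w hw => ?_)
    have h3 : (Aᵀ *ᵥ w) ⬝ᵥ (Aᵀ *ᵥ w) + (Bᵀ *ᵥ w) ⬝ᵥ (Bᵀ *ᵥ w) = 0 := by
      have := congrArg (w ⬝ᵥ ·) hw
      simp only [Matrix.mulVecLin_apply, Matrix.add_mulVec, ← Matrix.mulVec_mulVec,
        dotProduct_add, dotProduct_zero] at this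
      rwa [Matrix.dotProduct_mulVec w A, Matrix.dotProduct_mulVec w B, ← Matrix.mulVec_transpose,
        ← Matrix.mulVec_transpose] at this
    have hA0 := dotProduct_star_self_nonneg (Aᵀ *ᵥ w)
    have hB0 := dotProduct_star_self_nonneg (Bᵀ *ᵥ w)
    simp only [star_trivial] at hA0 hB0
    have hA : Aᵀ *ᵥ w = 0 := dotProduct_self_eq_zero.1 (by linarith)
    have hB : Bᵀ *ᵥ w = 0 := dotProduct_self_eq_zero.1 (by linarith)
    have h4 := congrArg Matrix.transpose h2
    simp only [Matrix.transpose_sub, Matrix.transpose_mul, Matrix.transpose_transpose,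
      Matrix.transpose_one] at h4
    rw [← Matrix.one_mulVec w, ← h4, Matrix.sub_mulVec, ← Matrix.mulVec_mulVec,
      ← Matrix.mulVec_mulVec, hA, hB]
    simp
  set p : ℝ[X] := (A.map Polynomial.C + (X : ℝ[X]) • B.map Polynomial.C).det
  -- `A + iB` is invertible because `(A + iB)(A - iB)ᵀ = AAᵀ + BBᵀ` is.
  have hp : p ≠ 0 := by
    intro hp
    have hI : Polynomial.aeval I p =
        (A.map (algebraMap ℝ ℂ) + I • B.map (algebraMap ℝ ℂ)).det := by
      rw [← AlgHom.coe_toRingHom, RingHom.map_det]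
      congr 1
      ext i j
      simp [Matrix.map_apply, mul_comm I]
    rw [hp, map_zero] at hI
    have hmul : (A.map (algebraMap ℝ ℂ) + I • B.map (algebraMap ℝ ℂ)) *
        (Aᵀ.map (algebraMap ℝ ℂ) - I • Bᵀ.map (algebraMap ℝ ℂ)) =
        (A * Aᵀ + B * Bᵀ).map (algebraMap ℝ ℂ) := by
      have h5 := congrArg (fun M => M.map (algebraMap ℝ ℂ)) h1
      simp only [Matrix.map_mul] at h5
      rw [Matrix.map_add _ (map_add _), Matrix.map_mul, Matrix.map_mul]
      simp only [add_mul, mul_sub, Matrix.smul_mul, Matrix.mul_smul, smul_smul, I_mul_I, h5,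
        neg_smul, one_smul]
      abel
    have hdet := congrArg Matrix.det hmul
    rw [Matrix.det_mul, ← hI, zero_mul] at hdet
    have h6 := RingHom.map_det (algebraMap ℝ ℂ) (A * Aᵀ + B * Bᵀ)
    rw [RingHom.mapMatrix_apply, ← hdet] at h6
    exact ((Matrix.isUnit_iff_isUnit_det _).1 hpd).ne_zero
      ((map_eq_zero_iff _ (algebraMap ℝ ℂ).injective).1 h6)
  obtain ⟨t, ht⟩ : ∃ t : ℝ, p.eval t ≠ 0 := by
    by_contra! h
    exact hp (Polynomial.funext fun t => by simp [h t])
  refine ⟨t, (Matrix.isUnit_iff_isUnit_det _).2 (isUnit_iff_ne_zero.2 ?_)⟩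
  rw [← Polynomial.coe_evalRingHom, RingHom.map_det] at ht
  convert ht using 2
  ext i j
  simp [Matrix.map_apply, mul_comm t]

/-- The image of the metaplectic projection. -/
def mpImage (n : ℕ) : Subgroup (Sp n) := (mpGraph n).map (MonoidHom.snd _ _)

theorem mem_mpImage_of_mpGenerator {S : Sp n} (h : ∃ T : UnitaryOp n, MpGenerator T S) :
    S ∈ mpImage n := by
  obtain ⟨T, hT⟩ := h
  exact ⟨(T, S), Subgroup.subset_closure hT, rfl⟩

theorem mem_mpImage_of_lower {P : Matrix (Fin n) (Fin n) ℝ} (hP : P.IsSymm) {S : Sp n}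
    (hS : (S : PhaseMatrix n) = Matrix.fromBlocks 1 0 P 1) : S ∈ mpImage n :=
  mem_mpImage_of_mpGenerator (exists_mpGenerator_chirp hP hS)

theorem fromBlocks_lower_mem {P : Matrix (Fin n) (Fin n) ℝ} (hP : P.IsSymm) :
    Matrix.fromBlocks 1 0 P 1 ∈ Matrix.symplecticGroup (Fin n) ℝ := by
  rw [SymplecticGroup.fromBlocks_mem_iff]
  simp [hP.eq]

/-- Upper shears are conjugate to lower shears by `J`. -/
theorem mem_mpImage_of_upper {P : Matrix (Fin n) (Fin n) ℝ} (hP : P.IsSymm) {S : Sp n}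
    (hS : (S : PhaseMatrix n) = Matrix.fromBlocks 1 P 0 1) : S ∈ mpImage n := by
  have hF : Matrix.fromBlocks 0 1 (-1) 0 ∈ Matrix.symplecticGroup (Fin n) ℝ := by
    rw [SymplecticGroup.fromBlocks_mem_iff]
    simp
  set F : Sp n := ⟨_, hF⟩
  set V : Sp n := ⟨_, fromBlocks_lower_mem (P := -P) hP.neg⟩
  have hFm : F ∈ mpImage n := mem_mpImage_of_mpGenerator (exists_mpGenerator_fourier rfl)
  have hVm : V ∈ mpImage n := mem_mpImage_of_lower hP.neg rfl
  have h : S = F * V * F⁻¹ := by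
    rw [eq_mul_inv_iff_mul_eq]
    refine Subtype.ext ?_
    rw [Submonoid.coe_mul, Submonoid.coe_mul, hS, Matrix.fromBlocks_multiply,
      Matrix.fromBlocks_multiply]
    simp
  rw [h]
  exact mul_mem (mul_mem hFm hVm) (inv_mem hFm)

/-- A symplectic matrix with invertible upper left block is the product of a lower shear, a scaling
and an upper shear. -/
theorem mem_mpImage_of_isUnit {A B C D : Matrix (Fin n) (Fin n) ℝ} (hA : IsUnit A) {S : Sp n}
    (hS : (S : PhaseMatrix n) = Matrix.fromBlocks A B C D) : S ∈ mpImage n := by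
  obtain ⟨a, rfl⟩ := hA
  have h1 := SymplecticGroup.fromBlocks_mem_iff.1 (hS ▸ S.2)
  have h2 := SymplecticGroup.transpose_mem (hS ▸ S.2)
  rw [Matrix.fromBlocks_transpose, SymplecticGroup.fromBlocks_mem_iff] at h2
  simp only [Matrix.transpose_transpose] at h2
  have e1 : (a⁻¹).1 * a.1 = 1 := Units.inv_mul a
  have e2 : a.1 * (a⁻¹).1 = 1 := Units.mul_inv a
  have e3 : (a.1)ᵀ * ((a⁻¹).1)ᵀ = 1 := by rw [← Matrix.transpose_mul, e1, Matrix.transpose_one]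
  have e4 : ((a⁻¹).1)ᵀ * (a.1)ᵀ = 1 := by rw [← Matrix.transpose_mul, e2, Matrix.transpose_one]
  have hP : (C * (a⁻¹).1).IsSymm := by
    calc (C * (a⁻¹).1)ᵀ = ((a⁻¹).1)ᵀ * (Cᵀ * a.1) * (a⁻¹).1 := by
          rw [Matrix.transpose_mul, mul_assoc, mul_assoc, e2, mul_one]
      _ = C * (a⁻¹).1 := by rw [← h1.1, ← mul_assoc, e4, one_mul]
  have hQ : ((a⁻¹).1 * B).IsSymm := by
    calc ((a⁻¹).1 * B)ᵀ = (a⁻¹).1 * (a.1 * Bᵀ) * ((a⁻¹).1)ᵀ := by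
          rw [Matrix.transpose_mul, ← mul_assoc, e1, one_mul]
      _ = (a⁻¹).1 * B := by rw [h2.1, mul_assoc, mul_assoc, e3, mul_one]
  have hM : Matrix.fromBlocks a.1 0 0 ((a⁻¹).1)ᵀ ∈ Matrix.symplecticGroup (Fin n) ℝ := by
    rw [SymplecticGroup.fromBlocks_mem_iff]
    simp [e3, -Matrix.coe_units_inv]
  have hU : Matrix.fromBlocks 1 ((a⁻¹).1 * B) 0 1 ∈ Matrix.symplecticGroup (Fin n) ℝ := by
    rw [SymplecticGroup.fromBlocks_mem_iff]
    simp [hQ.eq, -Matrix.transpose_mul, -Matrix.coe_units_inv]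
  have hD : D = C * (a⁻¹).1 * B + ((a⁻¹).1)ᵀ := by
    rw [← hP.eq, Matrix.transpose_mul]
    calc D = ((a⁻¹).1)ᵀ * ((a.1)ᵀ * D) := by rw [← mul_assoc, e4, one_mul]
      _ = _ := by rw [sub_eq_iff_eq_add.1 h1.2.2]; noncomm_ring
  have h : S = ⟨_, fromBlocks_lower_mem hP⟩ * ⟨_, hM⟩ * ⟨_, hU⟩ := by
    refine Subtype.ext ?_
    rw [Submonoid.coe_mul, Submonoid.coe_mul, hS, Matrix.fromBlocks_multiply,
      Matrix.fromBlocks_multiply]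
    simp only [one_mul, zero_mul, mul_one, mul_zero, add_zero, zero_add, mul_assoc, e1]
    rw [← mul_assoc a.1, e2, one_mul, hD, mul_assoc]
  rw [h]
  refine mul_mem (mul_mem (mem_mpImage_of_lower hP rfl) ?_) (mem_mpImage_of_upper hQ rfl)
  exact mem_mpImage_of_mpGenerator (exists_mpGenerator_scaling a⁻¹ (by simp))

/-- The metaplectic projection is onto. -/
theorem mem_mpImage (S : Sp n) : S ∈ mpImage n := by
  obtain ⟨A, B, C, D, hS⟩ : ∃ A B C D, (S : PhaseMatrix n) = Matrix.fromBlocks A B C D :=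
    ⟨_, _, _, _, (Matrix.fromBlocks_toBlocks _).symm⟩
  have h2 := SymplecticGroup.transpose_mem (hS ▸ S.2)
  rw [Matrix.fromBlocks_transpose, SymplecticGroup.fromBlocks_mem_iff] at h2
  simp only [Matrix.transpose_transpose] at h2
  obtain ⟨t, ht⟩ := exists_isUnit_add_smul h2.1 h2.2.2
  have hP : (t • (1 : Matrix (Fin n) (Fin n) ℝ)).IsSymm := Matrix.isSymm_one.smul t
  set V : Sp n := ⟨_, fromBlocks_lower_mem hP⟩
  have hV : V ∈ mpImage n := mem_mpImage_of_lower hP rfl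
  refine (Subgroup.mul_mem_cancel_right _ hV).1 (mem_mpImage_of_isUnit (B := B)
    (C := C + t • D) (D := D) ht ?_)
  rw [Submonoid.coe_mul, hS, Matrix.fromBlocks_multiply]
  simp

theorem exists_projectsTo (S : Sp n) : ∃ T : Mp n, ProjectsTo T S := by
  obtain ⟨⟨T, S'⟩, h, rfl⟩ := mem_mpImage S
  exact ⟨⟨T, ⟨(T, S'), h, rfl⟩⟩, h⟩

/-! ### Covariance of the cross-Wigner transform -/

theorem IsCovariant.crossWigner_mulVec {T : UnitaryOp n} {S : Sp n} (h : IsCovariant T S)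
    (u v : L2 n) (z : Phase n) :
    crossWigner (T u) (T v) ((S : PhaseMatrix n) *ᵥ z) = crossWigner u v z := by
  rw [crossWigner_eq_inner, crossWigner_eq_inner, ← h.2, LinearIsometryEquiv.inner_map_map]

theorem toTemperedDistribution_eq_inner (u : L2 n) (φ : 𝓢(Conf n, ℂ)) :
    Lp.toTemperedDistribution u φ = inner ℂ ((conjSchwartz φ).toLp 2 : L2 n) u := by
  rw [Lp.toTemperedDistribution_apply, L2.inner_def]
  refine integral_congr_ae ?_
  filter_upwards [(conjSchwartz φ).coeFn_toLp 2 volume] with y h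
  rw [h, conjSchwartz_apply]
  simp [mul_comm]

@[simp]
theorem conjSchwartz_conjSchwartz (φ : 𝓢(Conf n, ℂ)) : conjSchwartz (conjSchwartz φ) = φ := by
  ext y
  simp

theorem conjSchwartz_smul (a : ℂ) (φ : 𝓢(Conf n, ℂ)) :
    conjSchwartz (a • φ) = conj a • conjSchwartz φ := by
  ext y
  simp

/-- The conjugate `φ ↦ conj (A (conj φ))` of an operator on `𝓢(ℝⁿ)`. -/
def conjOperator (A : 𝓢(Conf n, ℂ) →L[ℂ] 𝓢(Conf n, ℂ)) : 𝓢(Conf n, ℂ) →L[ℂ] 𝓢(Conf n, ℂ) where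
  toFun φ := conjSchwartz (A (conjSchwartz φ))
  map_add' φ ψ := by simp
  map_smul' a φ := by simp [conjSchwartz_smul]
  cont := by fun_prop

/-- The transpose of the conjugate of `T⁻¹` extends the unitary operator `T` to `𝓢'(ℝⁿ)`. -/
theorem IsCovariant.exists_extendsL2 {T : UnitaryOp n} {S : Sp n} (h : IsCovariant T S) :
    ∃ T' : 𝓢'(Conf n, ℂ) →L[ℂ] 𝓢'(Conf n, ℂ), ExtendsL2 T T' := by
  obtain ⟨⟨A, hA⟩, -⟩ := h
  refine ⟨PointwiseConvergenceCLM.precomp ℂ (conjOperator (A.symm : _ →L[ℂ] _)), fun u => ?_⟩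
  ext φ
  have h1 : PointwiseConvergenceCLM.precomp ℂ (conjOperator (A.symm : _ →L[ℂ] _))
      (Lp.toTemperedDistribution u) φ =
      Lp.toTemperedDistribution u (conjSchwartz (A.symm (conjSchwartz φ))) := rfl
  rw [h1, toTemperedDistribution_eq_inner, toTemperedDistribution_eq_inner,
    conjSchwartz_conjSchwartz, ← LinearIsometryEquiv.inner_map_map T, ← hA, A.apply_symm_apply]

/-- `L²(ℝⁿ)` is dense in `𝓢'(ℝⁿ)`: a continuous functional on `𝓢'(ℝⁿ)` is the evaluation at some
Schwartz function `χ`, and it vanishes at `conj χ` only if `χ = 0`. -/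
theorem functional_eq_zero_of_L2 (ℓ : 𝓢'(Conf n, ℂ) →L[ℂ] ℂ)
    (h : ∀ u : L2 n, ℓ (Lp.toTemperedDistribution u) = 0) : ℓ = 0 := by
  obtain ⟨χ, hχ⟩ := LinearMap.dualEmbedding_surjective (topDualPairing ℂ 𝓢(Conf n, ℂ))
    (ℓ.comp ((PointwiseConvergenceCLM.equivWeakDual ℂ 𝓢(Conf n, ℂ)).symm :
      WeakDual ℂ 𝓢(Conf n, ℂ) →L[ℂ] 𝓢'(Conf n, ℂ)))
  have hval (u : 𝓢'(Conf n, ℂ)) : ℓ u = u χ := (DFunLike.congr_fun hχ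
    (PointwiseConvergenceCLM.equivWeakDual ℂ 𝓢(Conf n, ℂ) u)).symm
  have h0 := h ((conjSchwartz χ).toLp 2)
  rw [hval, toTemperedDistribution_eq_inner, inner_self_eq_zero] at h0
  have h1 : conjSchwartz χ = 0 := by
    refine SchwartzMap.injective_toLp 2 volume ?_
    refine h0.trans ?_
    exact ((SchwartzMap.toLpCLM ℂ ℂ 2 (volume : Measure (Conf n))).map_zero).symm
  have h2 : χ = 0 := by rw [← conjSchwartz_conjSchwartz χ, h1, map_zero]
  ext u
  rw [hval, h2, map_zero]
  rfl

theorem IsCovariant.crossWignerDist_mulVec {T : UnitaryOp n} {S : Sp n} (h : IsCovariant T S)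
    {T' : 𝓢'(Conf n, ℂ) →L[ℂ] 𝓢'(Conf n, ℂ)} (hT' : ExtendsL2 T T') {φ ψ : 𝓢(Conf n, ℂ)}
    (hψ : ψ.toLp 2 = T (φ.toLp 2)) (u : 𝓢'(Conf n, ℂ)) (z : Phase n) :
    crossWignerDist (T' u) ψ ((S : PhaseMatrix n) *ᵥ z) = crossWignerDist u φ z := by
  have key : (PointwiseConvergenceCLM.evalCLM (RingHom.id ℂ) ℂ
      (royerTest ((S : PhaseMatrix n) *ᵥ z) ψ)).comp T' -
      PointwiseConvergenceCLM.evalCLM (RingHom.id ℂ) ℂ (royerTest z φ) = 0 := by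
    refine functional_eq_zero_of_L2 _ fun w => ?_
    change T' (Lp.toTemperedDistribution w) (royerTest _ ψ) -
      Lp.toTemperedDistribution w (royerTest z φ) = 0
    have h1 := h.crossWigner_mulVec w (φ.toLp 2) z
    rw [← hψ, crossWigner_congr_ae .rfl (ψ.coeFn_toLp 2 volume),
      crossWigner_congr_ae .rfl (φ.coeFn_toLp 2 volume),
      ← crossWignerDist_toTemperedDistribution, ← crossWignerDist_toTemperedDistribution,
      crossWignerDist, crossWignerDist] at h1
    rw [hT', sub_eq_zero]
    refine mul_left_cancel₀ (pow_ne_zero n ?_) h1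
    exact one_div_ne_zero (ofReal_ne_zero.2 Real.pi_ne_zero)
  rw [crossWignerDist, crossWignerDist]
  congr 1
  exact sub_eq_zero.1 (DFunLike.congr_fun key u)

/-! ### Linear automorphisms pulling back the same form -/

theorem stdForm_eq (z z' : Phase n) : stdForm z z' = z ⬝ᵥ (Matrix.J (Fin n) ℝ *ᵥ z') := by
  rw [stdForm, Matrix.J, Matrix.fromBlocks_mulVec]
  simp only [EuclideanSpace.inner_eq_star_dotProduct, dotProduct, Fintype.sum_sum_type]
  simp [pos, mom, Matrix.neg_mulVec, mul_comm]
  ring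

theorem PullsBack.transpose_mul_mul {Ω : PhaseMatrix n} {f : PhaseAut n} (hf : PullsBack Ω f) :
    (f.1)ᵀ * Ω⁻¹ * f.1 = Matrix.J (Fin n) ℝ := by
  have h (z z' : Phase n) :
      z ⬝ᵥ (((f.1)ᵀ * Ω⁻¹ * f.1) *ᵥ z') = z ⬝ᵥ (Matrix.J (Fin n) ℝ *ᵥ z') := by
    rw [← stdForm_eq, ← hf, omegaForm, ← Matrix.mulVec_mulVec, ← Matrix.mulVec_mulVec,
      Matrix.dotProduct_mulVec z, Matrix.vecMul_transpose]
  ext i j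
  simpa using h (Pi.single i 1) (Pi.single j 1)

theorem PullsBack.mem_symplecticGroup {Ω : PhaseMatrix n} {f f' : PhaseAut n}
    (hf : PullsBack Ω f) (hf' : PullsBack Ω f') :
    (f⁻¹ * f').1 ∈ Matrix.symplecticGroup (Fin n) ℝ := by
  rw [SymplecticGroup.mem_iff', ← hf.transpose_mul_mul]
  have h : f.1 * (f⁻¹ * f').1 = f'.1 := by
    rw [← Units.val_mul, mul_inv_cancel_left]
  calc _ = (f.1 * (f⁻¹ * f').1)ᵀ * Ω⁻¹ * (f.1 * (f⁻¹ * f').1) := by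
        rw [Matrix.transpose_mul]; simp only [mul_assoc]
    _ = _ := by rw [h, hf'.transpose_mul_mul, hf.transpose_mul_mul]

theorem opM_symm_apply (f : PhaseAut n) (U : Phase n → ℂ) (z : Phase n) :
    (opM f).symm U z = ((√|(f⁻¹).1.det| : ℝ) : ℂ) * U ((f⁻¹).1 *ᵥ z) := rfl

/-- A relation `U'(S z) = U(z)` with `S = f⁻¹ f'` symplectic is the equality
`M_{f'}⁻¹ U = M_f⁻¹ U'`, because `det S = 1`. -/
theorem opM_symm_eq_opM_symm {f f' : PhaseAut n} {S : Sp n}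
    (hS : (S : PhaseMatrix n) = (f⁻¹ * f').1) {U U' : Phase n → ℂ}
    (h : ∀ z, U' ((S : PhaseMatrix n) *ᵥ z) = U z) : (opM f').symm U = (opM f).symm U' := by
  have hf : (f⁻¹).1 = (S : PhaseMatrix n) * (f'⁻¹).1 := by
    rw [hS, ← Units.val_mul, mul_inv_cancel_right]
  funext z
  rw [opM_symm_apply, opM_symm_apply, hf, Matrix.det_mul, SymplecticGroup.det_eq_one S.2, one_mul,
    ← Matrix.mulVec_mulVec, h]

theorem wavepacketMap_congr_ae (f : PhaseAut n) {φ φ' u u' : Conf n → ℂ} (hφ : φ =ᵐ[volume] φ')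
    (hu : u =ᵐ[volume] u') : wavepacketMap f φ u = wavepacketMap f φ' u' := by
  have h : wavepacket φ u = wavepacket φ' u' := by
    funext z
    rw [wavepacket, wavepacket, crossWigner_congr_ae hu hφ]
  rw [wavepacketMap, wavepacketMap, h]

theorem IsCovariant.wavepacketMap_eq {T : UnitaryOp n} {S : Sp n} (h : IsCovariant T S)
    {f f' : PhaseAut n} (hS : (S : PhaseMatrix n) = (f⁻¹ * f').1) (φ u : L2 n) :
    wavepacketMap f' φ u = wavepacketMap f (T φ) (T u) := by
  refine opM_symm_eq_opM_symm hS fun z => ?_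
  rw [wavepacket, wavepacket, h.crossWigner_mulVec]

theorem IsCovariant.wavepacketMap_schwartz_eq {T : UnitaryOp n} {S : Sp n} (h : IsCovariant T S)
    {f f' : PhaseAut n} (hS : (S : PhaseMatrix n) = (f⁻¹ * f').1) {φ u ψ v : 𝓢(Conf n, ℂ)}
    (hψ : ψ.toLp 2 = T (φ.toLp 2)) (hv : v.toLp 2 = T (u.toLp 2)) :
    wavepacketMap f' φ u = wavepacketMap f ψ v := by
  rw [wavepacketMap_congr_ae f' (φ.coeFn_toLp 2 volume).symm (u.coeFn_toLp 2 volume).symm,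
    wavepacketMap_congr_ae f (ψ.coeFn_toLp 2 volume).symm (v.coeFn_toLp 2 volume).symm, hψ, hv,
    h.wavepacketMap_eq hS]

theorem IsCovariant.wavepacketMapDist_eq {T : UnitaryOp n} {S : Sp n} (h : IsCovariant T S)
    {f f' : PhaseAut n} (hS : (S : PhaseMatrix n) = (f⁻¹ * f').1)
    {T' : 𝓢'(Conf n, ℂ) →L[ℂ] 𝓢'(Conf n, ℂ)} (hT' : ExtendsL2 T T') {φ ψ : 𝓢(Conf n, ℂ)}
    (hψ : ψ.toLp 2 = T (φ.toLp 2)) (u : 𝓢'(Conf n, ℂ)) :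
    wavepacketMapDist f' φ u = wavepacketMapDist f ψ (T' u) := by
  refine opM_symm_eq_opM_symm hS fun z => ?_
  rw [h.crossWignerDist_mulVec hT' hψ]

end PhaseSpaceWeyl

end

theorem mainTheorem9 (n : ℕ) (Ω : PhaseSpaceWeyl.PhaseMatrix n)
    (hΩ : Ωᵀ = -Ω) (hΩ' : IsUnit Ω.det)
    (f f' : PhaseSpaceWeyl.PhaseAut n)
    (hf : PhaseSpaceWeyl.PullsBack Ω f) (hf' : PhaseSpaceWeyl.PullsBack Ω f') :
    ∃ S : PhaseSpaceWeyl.Sp n, (S : PhaseSpaceWeyl.PhaseMatrix n) = (f⁻¹ * f').1 ∧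
      -- there is a metaplectic operator with projection `f⁻¹ f'`
      (∃ T : PhaseSpaceWeyl.Mp n, PhaseSpaceWeyl.ProjectsTo T S) ∧
      -- and for every such operator:
      ∀ T : PhaseSpaceWeyl.Mp n, PhaseSpaceWeyl.ProjectsTo T S →
        -- it maps Schwartz functions to Schwartz functions
        (∀ φ : 𝓢(PhaseSpaceWeyl.Conf n, ℂ), ∃ ψ : 𝓢(PhaseSpaceWeyl.Conf n, ℂ),
          ψ.toLp 2 = T.1 (φ.toLp 2)) ∧
        -- the identity for Schwartz functions
        (∀ φ u ψ v : 𝓢(PhaseSpaceWeyl.Conf n, ℂ),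
          ψ.toLp 2 = T.1 (φ.toLp 2) → v.toLp 2 = T.1 (u.toLp 2) →
          PhaseSpaceWeyl.wavepacketMap f' φ u = PhaseSpaceWeyl.wavepacketMap f ψ v) ∧
        -- the identity for square integrable functions
        (∀ φ u : PhaseSpaceWeyl.L2 n,
          PhaseSpaceWeyl.wavepacketMap f' φ u =
            PhaseSpaceWeyl.wavepacketMap f (T.1 φ) (T.1 u)) ∧
        -- the operator extends to tempered distributions
        (∃ T' : 𝓢'(PhaseSpaceWeyl.Conf n, ℂ) →L[ℂ] 𝓢'(PhaseSpaceWeyl.Conf n, ℂ),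
          PhaseSpaceWeyl.ExtendsL2 T.1 T') ∧
        -- the identity for tempered distributions
        (∀ T' : 𝓢'(PhaseSpaceWeyl.Conf n, ℂ) →L[ℂ] 𝓢'(PhaseSpaceWeyl.Conf n, ℂ),
          PhaseSpaceWeyl.ExtendsL2 T.1 T' →
          ∀ φ ψ : 𝓢(PhaseSpaceWeyl.Conf n, ℂ), ψ.toLp 2 = T.1 (φ.toLp 2) →
          ∀ u : 𝓢'(PhaseSpaceWeyl.Conf n, ℂ),
            PhaseSpaceWeyl.wavepacketMapDist f' φ u =
              PhaseSpaceWeyl.wavepacketMapDist f ψ (T' u)) := by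
  obtain ⟨S, hS⟩ : ∃ S : PhaseSpaceWeyl.Sp n, (S : PhaseSpaceWeyl.PhaseMatrix n) = (f⁻¹ * f').1 :=
    ⟨⟨_, hf.mem_symplecticGroup hf'⟩, rfl⟩
  refine ⟨S, hS, PhaseSpaceWeyl.exists_projectsTo S, fun T hT => ?_⟩
  have hcov : PhaseSpaceWeyl.IsCovariant T.1 S := PhaseSpaceWeyl.isCovariant_of_mem_mpGraph hT
  obtain ⟨A, hA⟩ := hcov.1
  exact ⟨fun φ => ⟨A φ, hA φ⟩, fun φ u ψ v => hcov.wavepacketMap_schwartz_eq hS,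
    hcov.wavepacketMap_eq hS, hcov.exists_extendsL2,
    fun T' hT' φ ψ hψ => hcov.wavepacketMapDist_eq hS hT' hψ⟩
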